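/- Let $|\psi_2\rangle,|\psi_3\rangle$ be the graph states of the linear graphs $1-2$ and $1-2-3$ (each qubit is prepared in $(|0\rangle+|1\rangle)/\sqrt2$ and a controlled-phase gate is applied along each edge). For $n\in\{2,3\}$, $\mathrm{diag}(\lambda_j)_{j\in\{0,1\}^n}$ denotes the operator $\sum_j \lambda_j\, Z^{j}|\psi_n\rangle\langle\psi_n|Z^{j}$, $Z^j=\bigotimes_k Z^{j_k}$, with the labels $j=j_1\dots j_n$ in binary order. For $p\in[0,1]$ let $\rho_p=\mathcal E^1_p\mathcal E^2_p\mathcal E^3_p(|\psi_3\rangle\langle\psi_3|)$, where $$\mathcal E^i_p(\rho)=(1-p)\rho+\tfrac p3(X_i\rho X_i+Y_i\rho Y_i+Z_i\rho Z_i).$$ By LOCC we mean finitely many rounds in which each party applies a complete quantum measurement to its own finite-dimensional system (ancillas may be added and systems discarded) and broadcasts the outcome, on which the later rounds may depend; SLOCC means LOCC followed by post-selection on a set of outcomes of nonzero total probability. A state $\rho$ of several parties is purifiable to a unit vector $|\psi\rangle$ if for every $\varepsilon>0$ there are an $n$ and an SLOCC protocol that turns $\rho^{\otimes n}$ (each party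 holding its part of every copy) into a state whose fidelity $\langle\psi|\cdot|\psi\rangle$ is at least $1-\varepsilon$. Put $x=1-\frac{4p}3$, $a=\frac{1+3x^2+4x^3}8$, $b=\frac{1-x^2}8$, $c=\frac{1+3x^2-4x^3}8$. Then for every $p\in[0,1]$: 1. $\rho_p=\mathrm{diag}(a,b,c,b,b,b,b,b)$. 2. $w:=a+2b+c>0$, $b\ge0$, $w+4b=1$ and $\rho_p=w\,\tau_0+4b\,\tau_1$, where $\tau_0=\frac1w\mathrm{diag}(a,0,c,0,b,0,b,0)$ and $\tau_1=\frac14\mathrm{diag}(0,1,0,1,0,1,0,1)$, i.e. in the graph-state basis $\tau_0=\frac1w\mathrm{diag}(a,c,b,b)\otimes|0\rangle\langle0|$ and $\tau_1=\frac14\mathrm{diag}(1,1,1,1)\otimes|1\rangle\langle 1|$. 3. Let Alice hold qubit 1 and Bob qubits 2 and 3. The two-qubit state $\rho_2=\frac1w\mathrm{diag}(a,c,b,b)$, one qubit held by each of them, can be converted with certainty by LOCC into $\tau_0$; the state $\tau_1$ can be prepared by LOCC from nothing; and $\rho_2$ can be converted with certainty by LOCC into $\rho_p$. 4. $\frac{a}{a+2b+c}\le\frac12$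 if and only if $27-126p+156p^2-64p^3\le0$, and in that case $\rho_p$, its three qubits held by three different parties, is not purifiable to $|\psi_3\rangle$. Moreover, there is a root $p_0$ of $27-126p+156p^2-64p^3$ with $|p_0-0.332|<0.0005$ such that for $p\in[0,1]$ the inequality in 4 holds if and only if $p\ge p_0$; so purification is impossible for every $p\in[p_0,1]$. -/

import Mathlib

namespace GraphPurification

open Matrix

/-- Operators on the joint space of the parties `k : P`, where party `k` holds a system with
computational basis `Fin (d k)`. -/
abbrev Op {P : Type} (d : P → ℕ) : Type :=
  Matrix (∀ k, Fin (d k)) (∀ k, Fin (d k)) ℂ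

/-- State vectors, given by their amplitudes in the computational product basis. -/
abbrev Ket {P : Type} (d : P → ℕ) : Type := (∀ k, Fin (d k)) → ℂ

/-- The projector (for a unit vector) `|ψ⟩⟨ψ|`. -/
def proj {P : Type} {d : P → ℕ} (ψ : Ket d) : Op d := vecMulVec ψ (star ψ)

/-- The tensor product `⨂ₖ A k` of local operators. -/
def localTensor {P : Type} [Fintype P] {d d' : P → ℕ}
    (A : ∀ k, Matrix (Fin (d' k)) (Fin (d k)) ℂ) :
    Matrix (∀ k, Fin (d' k)) (∀ k, Fin (d k)) ℂ :=
  Matrix.of fun x y => ∏ k, A k (x k) (y k)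

/-! ### Qubits, graph states and noise -/

def pauliX : Matrix (Fin 2) (Fin 2) ℂ := !![0, 1; 1, 0]
def pauliY : Matrix (Fin 2) (Fin 2) ℂ := !![0, -Complex.I; Complex.I, 0]
def pauliZ : Matrix (Fin 2) (Fin 2) ℂ := !![1, 0; 0, -1]

/-- The local dimensions of `n` qubits. -/
abbrev qubits (n : ℕ) : Fin n → ℕ := fun _ => 2

/-- The one-qubit operator `U` acting on qubit `i`. -/
def onQubit {n : ℕ} (i : Fin n) (U : Matrix (Fin 2) (Fin 2) ℂ) : Op (qubits n) :=
  localTensor (d := qubits n) (d' := qubits n) fun k => if k = i then U else 1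

/-- The graph state of `G`: every qubit is prepared in `(|0⟩ + |1⟩)/√2` and a controlled-phase
gate (sign `-1` when both qubits are `1`) is applied along every edge. -/
noncomputable def graphState {n : ℕ} (G : SimpleGraph (Fin n)) [DecidableRel G.Adj] :
    Ket (qubits n) := fun x =>
  (((1 / Real.sqrt 2) ^ n : ℝ) : ℂ) *
    ∏ i, ∏ j, if i < j ∧ G.Adj i j ∧ x i = 1 ∧ x j = 1 then -1 else 1

/-- The graph-state basis vector `Z_j |ψ_G⟩`, where `j` tells which qubits carry a `Z`. -/
noncomputable def graphBasis {n : ℕ} (G : SimpleGraph (Fin n)) [DecidableRel G.Adj]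
    (j : Fin n → Fin 2) : Ket (qubits n) :=
  localTensor (d := qubits n) (d' := qubits n) (fun k => if j k = 1 then pauliZ else 1) *ᵥ
    graphState G

/-- The operator that is diagonal in the graph-state basis with diagonal entries `l j`. -/
noncomputable def graphDiag {n : ℕ} (G : SimpleGraph (Fin n)) [DecidableRel G.Adj]
    (l : (Fin n → Fin 2) → ℝ) : Op (qubits n) :=
  ∑ j, (l j : ℂ) • proj (graphBasis G j)

/-- Local noise on qubit `i`: with probability `p` one of `X`, `Y`, `Z` happens, each equally
likely. -/
noncomputable def depolarize {n : ℕ} (p : ℝ) (i : Fin n) (ρ : Op (qubits n)) : Op (qubits n) :=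
  ((1 - p : ℝ) : ℂ) • ρ + ((p / 3 : ℝ) : ℂ) •
    (onQubit i pauliX * ρ * onQubit i pauliX + onQubit i pauliY * ρ * onQubit i pauliY +
      onQubit i pauliZ * ρ * onQubit i pauliZ)

/-- The graph state of `G` after the noise has acted on each of its qubits. -/
noncomputable def noisyGraphState {n : ℕ} (G : SimpleGraph (Fin n)) [DecidableRel G.Adj]
    (p : ℝ) : Op (qubits n) :=
  (List.finRange n).foldr (depolarize p) (proj (graphState G))

/-! ### Stochastic local operations and classical communication -/

/-- Protocols of local operations and classical communication with post-selection, from local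
dimensions `d` (the index) to local dimensions `e`. In a round every party `k` performs a complete
measurement on its own system, with Kraus operators `K k i` and outcomes `i : Fin (r k)`; all
outcomes are broadcast, and the rest of the protocol may depend on them. The local dimensions may
change, so that ancillas can be added and systems can be discarded. A branch ends by being accepted
or by being rejected. -/
inductive SLOCC {P : Type} (e : P → ℕ) : (P → ℕ) → Type
  | accept : SLOCC e e
  | reject (d : P → ℕ) : SLOCC e d
  | round (d : P → ℕ) (r : P → ℕ) (d' : ∀ k, Fin (r k) → ℕ)
      (K : ∀ k, ∀ i : Fin (r k), Matrix (Fin (d' k i)) (Fin (d k)) ℂ)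
      (complete : ∀ k, ∑ i, (K k i)ᴴ * K k i = 1)
      (next : ∀ o : (∀ k, Fin (r k)), SLOCC e (fun k => d' k (o k))) : SLOCC e d

/-- The unnormalized output of a protocol: the sum of the accepted branches, each weighted with its
probability. Its trace is the probability of acceptance. -/
def SLOCC.run {P : Type} [Fintype P] [DecidableEq P] {e : P → ℕ} :
    {d : P → ℕ} → SLOCC e d → Op d → Op e
  | _, .accept, ρ => ρ
  | _, .reject _, _ => 0
  | _, .round _ _ _ K _ next, ρ =>
      ∑ o, (next o).run
        (localTensor (fun k => K k (o k)) * ρ * (localTensor fun k => K k (o k))ᴴ)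

/-- `ρ` is turned into `σ` by local operations and classical communication with certainty
(the probability of acceptance is `1` when both have trace `1`). -/
def Convertible {P : Type} [Fintype P] [DecidableEq P] {d e : P → ℕ} (ρ : Op d) (σ : Op e) :
    Prop :=
  ∃ L : SLOCC e d, L.run ρ = σ

/-- `n` copies of `ρ`, where each party holds its part of every copy. -/
def copies {P : Type} {d : P → ℕ} (n : ℕ) (ρ : Op d) : Op (fun k => d k ^ n) :=
  Matrix.of fun x y => ∏ i : Fin n,
    ρ (fun k => finFunctionFinEquiv.symm (x k) i) (fun k => finFunctionFinEquiv.symm (y k) i)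

/-- `ρ` can be purified to `ψ`: from sufficiently many copies of `ρ`, the parties can produce by
local operations and classical communication, with nonzero probability, a state whose fidelity with
the unit vector `ψ` is as close to `1` as desired. -/
def Purifiable {P : Type} [Fintype P] [DecidableEq P] {d : P → ℕ} (ρ : Op d) (ψ : Ket d) : Prop :=
  ∀ ε : ℝ, 0 < ε → ∃ (n : ℕ) (L : SLOCC d (fun k => d k ^ n)),
    0 < (L.run (copies n ρ)).trace.re ∧
      (1 - ε) * (L.run (copies n ρ)).trace.re ≤
        (star ψ ⬝ᵥ (L.run (copies n ρ) *ᵥ ψ)).re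

/-! ### The chain of three qubits -/

/-- The linear graph on `n` vertices. -/
abbrev chain (n : ℕ) : SimpleGraph (Fin n) := SimpleGraph.pathGraph n

instance (n : ℕ) : DecidableRel (chain n).Adj := fun _ _ =>
  decidable_of_iff _ SimpleGraph.pathGraph_adj.symm

/-- The weight of `000`. -/
noncomputable def wa (p : ℝ) : ℝ := (1 + 3 * (1 - 4 * p / 3) ^ 2 + 4 * (1 - 4 * p / 3) ^ 3) / 8
/-- The weight of every label other than `000` and `010`. -/
noncomputable def wb (p : ℝ) : ℝ := (1 - (1 - 4 * p / 3) ^ 2) / 8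
/-- The weight of `010`. -/
noncomputable def wc (p : ℝ) : ℝ := (1 + 3 * (1 - 4 * p / 3) ^ 2 - 4 * (1 - 4 * p / 3) ^ 3) / 8

/-- `diag(a, b, c, b, b, b, b, b)` in the graph-state basis of the three-qubit chain, the labels
`j = j₀j₁j₂` being in binary order. -/
noncomputable def chainDiag (p : ℝ) : Op (qubits 3) :=
  graphDiag (chain 3) fun j =>
    ![![![wa p, wb p], ![wc p, wb p]], ![![wb p, wb p], ![wb p, wb p]]] (j 0) (j 1) (j 2)

/-- The two-qubit weights `(a, c, b, b) / (a + 2b + c)`, in binary order. -/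
noncomputable def pairWeight (p : ℝ) (j₀ j₁ : Fin 2) : ℝ :=
  ![![wa p, wc p], ![wb p, wb p]] j₀ j₁ / (wa p + 2 * wb p + wc p)

/-- The two-qubit state `diag(a, c, b, b) / (a + 2b + c)` in the graph-state basis. -/
noncomputable def pairState (p : ℝ) : Op (qubits 2) :=
  graphDiag (chain 2) fun j => pairWeight p (j 0) (j 1)

/-- `diag(a, c, b, b) / (a + 2b + c) ⊗ |0⟩⟨0|` in the graph-state basis of the three-qubit chain:
the two-qubit state, perfectly connected to a third qubit. -/
noncomputable def pairPart (p : ℝ) : Op (qubits 3) :=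
  graphDiag (chain 3) fun j => if j 2 = 0 then pairWeight p (j 0) (j 1) else 0

/-- `diag(1, 1, 1, 1) / 4 ⊗ |1⟩⟨1|` in the graph-state basis of the three-qubit chain: the first
two qubits are maximally mixed, perfectly connected to a third qubit that carries a `Z`. -/
noncomputable def mixedPart : Op (qubits 3) :=
  graphDiag (chain 3) fun j => if j 2 = 1 then 1 / 4 else 0

/-- Two parties: the first holds the first qubit, the second holds the second and third qubits. -/
abbrev aliceBob : Fin 2 → ℕ := ![2, 2 * 2]

/-- The three qubits described by a joint basis label of the two parties. -/
def splitLabel (y : ∀ k, Fin (aliceBob k)) : Fin 3 → Fin 2 :=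
  let z : Fin 2 × Fin 2 := finProdFinEquiv.symm (y 1)
  ![y 0, z.1, z.2]

/-- A three-qubit operator, regarded as an operator of the two parties. -/
def bipartite (ρ : Op (qubits 3)) : Op aliceBob := ρ.submatrix splitLabel splitLabel

end GraphPurification

/-! In the graph basis everything is explicit: the entries of the basis projectors are products of
controlled-phase signs, and with x = 1 - 4p/3 the noise acts entrywise, so
`noisyGraphState_chain_three` is a finite comparison of polynomials in p.

Conversions: splitting the weights by the label of the third qubit gives `chainDiag_eq_mix`. Bob
gets the first component from the pair by the local isometry attaching a qubit in |+⟩ with a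
controlled phase. The second is separable: a maximally mixed qubit for Alice, an equal mixture of
|0⟩|-⟩ and |1⟩|+⟩ for Bob. A public coin (`Convertible.mix`) combines the two.

Impossibility does not go through these conversions; it uses the partial transpose on the first
qubit. Its positivity survives taking copies and running any SLOCC protocol, and it forces overlap
at most 1/2 with the chain state (`overlap_le_half`), which is maximally entangled across 1|23. By
`partialTranspose_graphDiag` the noisy state has positive partial transpose as soon as a ≤ w/2,
where w = a + 2b + c; this is the stated cubic inequality. -/

namespace GraphPurification

open Matrix
open scoped ComplexOrder

/-! ### Matrix entries in the graph basis. -/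

/-- The sign of a controlled phase gate. -/
def czSign (a b : Fin 2) : ℂ := if a = 1 ∧ b = 1 then -1 else 1

theorem localTensor_diagonal {P : Type} [Fintype P] [DecidableEq P] {d : P → ℕ}
    (D : ∀ k, Fin (d k) → ℂ) :
    localTensor (fun k => diagonal (D k)) = diagonal fun x => ∏ k, D k (x k) := by
  ext x y
  rw [localTensor, Matrix.of_apply]
  by_cases h : x = y
  · subst h; simp
  · obtain ⟨k, hk⟩ := Function.ne_iff.mp h
    rw [diagonal_apply_ne _ h]
    exact Finset.prod_eq_zero (Finset.mem_univ k) (diagonal_apply_ne _ hk)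

theorem graphBasis_apply {n : ℕ} (G : SimpleGraph (Fin n)) [DecidableRel G.Adj]
    (j x : Fin n → Fin 2) :
    graphBasis G j x = (∏ k, czSign (j k) (x k)) * graphState G x := by
  have h : (fun k => if j k = 1 then pauliZ else 1) = fun k => diagonal (czSign (j k)) := by
    ext k a b
    generalize j k = c
    fin_cases c <;> fin_cases a <;> fin_cases b <;> simp [pauliZ, czSign]
  rw [graphBasis, h, localTensor_diagonal, mulVec_diagonal]

theorem graphState_chain_two (x : Fin 2 → Fin 2) :
    graphState (chain 2) x = (((1 / √2) ^ 2 : ℝ) : ℂ) * czSign (x 0) (x 1) := by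
  simp [graphState, Fin.prod_univ_succ, SimpleGraph.pathGraph_adj, czSign]

theorem graphState_chain_three (x : Fin 3 → Fin 2) :
    graphState (chain 3) x =
      (((1 / √2) ^ 3 : ℝ) : ℂ) * (czSign (x 0) (x 1) * czSign (x 1) (x 2)) := by
  simp [graphState, Fin.prod_univ_succ, SimpleGraph.pathGraph_adj, czSign]

theorem star_czSign (a b : Fin 2) : star (czSign a b) = czSign a b := by
  unfold czSign; split_ifs <;> simp

theorem proj_graphBasis_chain_two (j x y : Fin 2 → Fin 2) :
    proj (graphBasis (chain 2) j) x y = 1 / 4 *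
      (czSign (j 0) (x 0) * czSign (j 1) (x 1) * czSign (x 0) (x 1) *
        (czSign (j 0) (y 0) * czSign (j 1) (y 1) * czSign (y 0) (y 1))) := by
  have h : (((1 / √2) ^ 2 : ℝ) : ℂ) * (((1 / √2) ^ 2 : ℝ) : ℂ) = 1 / 4 := by
    rw [← Complex.ofReal_mul, div_pow, Real.sq_sqrt (by norm_num)]; norm_num
  rw [proj, vecMulVec_apply, Pi.star_apply, graphBasis_apply, graphBasis_apply,
    graphState_chain_two, graphState_chain_two, ← h]
  simp only [Fin.prod_univ_two, star_mul', star_czSign, Complex.star_def, Complex.conj_ofReal]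
  ring

theorem proj_graphBasis_chain_three (j x y : Fin 3 → Fin 2) :
    proj (graphBasis (chain 3) j) x y = 1 / 8 *
      (czSign (j 0) (x 0) * czSign (j 1) (x 1) * czSign (j 2) (x 2) *
          czSign (x 0) (x 1) * czSign (x 1) (x 2) *
        (czSign (j 0) (y 0) * czSign (j 1) (y 1) * czSign (j 2) (y 2) *
          czSign (y 0) (y 1) * czSign (y 1) (y 2))) := by
  have h : (((1 / √2) ^ 3 : ℝ) : ℂ) * (((1 / √2) ^ 3 : ℝ) : ℂ) = 1 / 8 := by
    rw [← Complex.ofReal_mul, ← mul_pow, div_mul_div_comm, Real.mul_self_sqrt (by norm_num)]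
    norm_num
  rw [proj, vecMulVec_apply, Pi.star_apply, graphBasis_apply, graphBasis_apply,
    graphState_chain_three, graphState_chain_three, ← h]
  simp only [Fin.prod_univ_three, star_mul', star_czSign, Complex.star_def, Complex.conj_ofReal]
  ring

theorem sum_fin_two_arrow {M : Type*} [AddCommMonoid M] (f : (Fin 2 → Fin 2) → M) :
    ∑ j, f j = ∑ a, ∑ b, f ![a, b] := by
  rw [← (finTwoArrowEquiv (Fin 2)).symm.sum_comp, Fintype.sum_prod_type]
  rfl

theorem sum_fin_three_arrow {M : Type*} [AddCommMonoid M] (f : (Fin 3 → Fin 2) → M) :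
    ∑ j, f j = ∑ a, ∑ b, ∑ c, f ![a, b, c] := by
  rw [← (Fin.consEquiv fun _ : Fin 3 => Fin 2).sum_comp, Fintype.sum_prod_type]
  refine Finset.sum_congr rfl fun a _ => ?_
  rw [sum_fin_two_arrow]
  rfl

theorem graphDiag_chain_two_apply (l : (Fin 2 → Fin 2) → ℝ) (x y : Fin 2 → Fin 2) :
    graphDiag (chain 2) l x y = ∑ a, ∑ b, (l ![a, b] : ℂ) * (1 / 4 *
      (czSign a (x 0) * czSign b (x 1) * czSign (x 0) (x 1) *
        (czSign a (y 0) * czSign b (y 1) * czSign (y 0) (y 1)))) := by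
  rw [graphDiag, sum_fin_two_arrow]
  simp only [Matrix.sum_apply, Matrix.smul_apply, smul_eq_mul, proj_graphBasis_chain_two]
  rfl

theorem graphDiag_chain_three_apply (l : (Fin 3 → Fin 2) → ℝ) (x y : Fin 3 → Fin 2) :
    graphDiag (chain 3) l x y = ∑ a, ∑ b, ∑ c, (l ![a, b, c] : ℂ) * (1 / 8 *
      (czSign a (x 0) * czSign b (x 1) * czSign c (x 2) *
          czSign (x 0) (x 1) * czSign (x 1) (x 2) *
        (czSign a (y 0) * czSign b (y 1) * czSign c (y 2) *
          czSign (y 0) (y 1) * czSign (y 1) (y 2)))) := by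
  rw [graphDiag, sum_fin_three_arrow]
  simp only [Matrix.sum_apply, Matrix.smul_apply, smul_eq_mul, proj_graphBasis_chain_three]
  rfl

/-! ### Local noise on the three-qubit chain. -/

theorem graphState_eq_graphBasis {n : ℕ} (G : SimpleGraph (Fin n)) [DecidableRel G.Adj] :
    graphState G = graphBasis G 0 := by
  ext x
  simp [graphBasis_apply, czSign]

theorem onQubit_apply {n : ℕ} (i : Fin n) (U : Matrix (Fin 2) (Fin 2) ℂ) (x y : Fin n → Fin 2) :
    onQubit i U x y = ∑ a, if y = Function.update x i a then U (x i) a else 0 := by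
  rw [onQubit, localTensor, Matrix.of_apply]
  by_cases h : y = Function.update x i (y i)
  · rw [Finset.prod_eq_single i, Finset.sum_eq_single (y i)]
    · simp [← h]
    · intro a _ ha
      rw [if_neg]
      intro h'
      exact ha (by rw [h']; simp)
    · simp
    · intro k _ hk
      have hxy : x k = y k := by rw [h]; simp [hk]
      rw [if_neg hk]
      exact hxy ▸ Matrix.one_apply_eq (x k)
    · simp
  · have h0 : ∀ a, y ≠ Function.update x i a := by
      rintro a rfl
      simp at h
    simp only [h0, if_false, Finset.sum_const_zero]
    obtain ⟨k, hk⟩ := Function.ne_iff.mp h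
    have hki : k ≠ i := by
      rintro rfl
      simp at hk
    apply Finset.prod_eq_zero (Finset.mem_univ k)
    rw [if_neg hki, Matrix.one_apply_ne]
    simpa [hki, eq_comm] using hk

theorem onQubit_transpose {n : ℕ} (i : Fin n) (U : Matrix (Fin 2) (Fin 2) ℂ) :
    (onQubit i U)ᵀ = onQubit i Uᵀ := by
  ext x y
  simp only [onQubit, localTensor, Matrix.transpose_apply, Matrix.of_apply]
  refine Finset.prod_congr rfl fun k _ => ?_
  split_ifs
  · rfl
  · simp [Matrix.one_apply, eq_comm]

theorem onQubit_mul_apply {n : ℕ} (i : Fin n) (U : Matrix (Fin 2) (Fin 2) ℂ) (ρ : Op (qubits n))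
    (x y : Fin n → Fin 2) :
    (onQubit i U * ρ) x y = ∑ a, U (x i) a * ρ (Function.update x i a) y := by
  simp only [Matrix.mul_apply, onQubit_apply, Finset.sum_mul]
  rw [Finset.sum_comm]
  refine Finset.sum_congr rfl fun a _ => ?_
  simp [ite_mul]

theorem mul_onQubit_apply {n : ℕ} (i : Fin n) (U : Matrix (Fin 2) (Fin 2) ℂ) (ρ : Op (qubits n))
    (x y : Fin n → Fin 2) :
    (ρ * onQubit i U) x y = ∑ a, ρ x (Function.update y i a) * U a (y i) := by
  rw [← Matrix.transpose_apply (ρ * onQubit i U), Matrix.transpose_mul, onQubit_transpose,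
    onQubit_mul_apply]
  simp [mul_comm]

/-- Where the labels differ at `i`, the X and Y terms cancel and Z changes the sign, leaving the
factor 1 - p - p/3. Where they agree, Z acts trivially and X, Y both flip the bit. -/
theorem depolarize_apply {n : ℕ} (p : ℝ) (i : Fin n) (ρ : Op (qubits n)) (x y : Fin n → Fin 2) :
    depolarize p i ρ x y =
      if x i = y i then (1 - 2 * p / 3 : ℂ) * ρ x y +
        2 * p / 3 * ρ (Function.update x i (1 - x i)) (Function.update y i (1 - y i))
      else (1 - 4 * p / 3 : ℂ) * ρ x y := by
  have hx : ∀ a, x i = a → Function.update x i a = x := by rintro a rfl; simp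
  have hy : ∀ a, y i = a → Function.update y i a = y := by rintro a rfl; simp
  simp only [depolarize, Matrix.add_apply, Matrix.smul_apply, smul_eq_mul, mul_onQubit_apply,
    onQubit_mul_apply, Fin.sum_univ_two]
  have h2 : ∀ a : Fin 2, a = 0 ∨ a = 1 := by decide
  rcases h2 (x i) with h | h <;> rcases h2 (y i) with h' | h' <;>
    simp only [h, h', pauliX, pauliY, pauliZ, hx _ h, hy _ h'] <;>
    simp [hx _ h, hy _ h'] <;> ring_nf <;> simp <;> ring

set_option maxHeartbeats 4000000 in
theorem noisyGraphState_chain_three (p : ℝ) :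
    noisyGraphState (chain 3) p = chainDiag p := by
  have hf : List.finRange 3 = [0, 1, 2] := rfl
  ext x y
  rw [noisyGraphState, hf, chainDiag, graphDiag_chain_three_apply, graphState_eq_graphBasis]
  simp only [List.foldr, depolarize_apply, proj_graphBasis_chain_three]
  have e1 : ∀ (z : Fin 3 → Fin 2) (a : Fin 2), Function.update z 0 a 1 = z 1 := by simp
  have e2 : ∀ (z : Fin 3 → Fin 2) (a : Fin 2), Function.update z 0 a 2 = z 2 := by simp
  have e3 : ∀ (z : Fin 3 → Fin 2) (a : Fin 2), Function.update z 1 a 0 = z 0 := by simp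
  have e4 : ∀ (z : Fin 3 → Fin 2) (a : Fin 2), Function.update z 1 a 2 = z 2 := by simp
  have e5 : ∀ (z : Fin 3 → Fin 2) (a : Fin 2), Function.update z 2 a 0 = z 0 := by simp
  have e6 : ∀ (z : Fin 3 → Fin 2) (a : Fin 2), Function.update z 2 a 1 = z 1 := by simp
  simp only [Function.update_self, e1, e2, e3, e4, e5, e6, Fin.sum_univ_two, Pi.zero_apply]
  generalize x 0 = x0, x 1 = x1, x 2 = x2, y 0 = y0, y 1 = y1, y 2 = y2
  fin_cases x0 <;> fin_cases x1 <;> fin_cases x2 <;> fin_cases y0 <;> fin_cases y1 <;>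
    fin_cases y2 <;> simp [czSign, wa, wb, wc] <;> ring

/-! ### Partial transposition and its preservation under SLOCC. -/

section PartialTranspose

variable {P : Type} [DecidableEq P]

/-- The partial transpose of `ρ` with respect to the system of the party `k₀`. -/
def partialTranspose {d : P → ℕ} (k₀ : P) (ρ : Op d) : Op d :=
  Matrix.of fun x y => ρ (Function.update x k₀ (y k₀)) (Function.update y k₀ (x k₀))

theorem partialTranspose_apply {d : P → ℕ} (k₀ : P) (ρ : Op d) (x y : ∀ k, Fin (d k)) :
    partialTranspose k₀ ρ x y =
      ρ (Function.update x k₀ (y k₀)) (Function.update y k₀ (x k₀)) := rfl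

/-- Exchange the `k₀`-components of two labels. -/
def swapAt {d : P → ℕ} (k₀ : P) :
    (∀ k, Fin (d k)) × (∀ k, Fin (d k)) ≃ (∀ k, Fin (d k)) × (∀ k, Fin (d k)) where
  toFun u := (Function.update u.1 k₀ (u.2 k₀), Function.update u.2 k₀ (u.1 k₀))
  invFun u := (Function.update u.1 k₀ (u.2 k₀), Function.update u.2 k₀ (u.1 k₀))
  left_inv u := by simp
  right_inv u := by simp

theorem partialTranspose_zero {d : P → ℕ} (k₀ : P) : partialTranspose k₀ (0 : Op d) = 0 := rfl

theorem partialTranspose_sum {d : P → ℕ} (k₀ : P) {ι : Type} (s : Finset ι) (ρ : ι → Op d) :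
    partialTranspose k₀ (∑ i ∈ s, ρ i) = ∑ i ∈ s, partialTranspose k₀ (ρ i) := by
  ext x y
  simp [partialTranspose_apply, Matrix.sum_apply]

theorem trace_partialTranspose_mul [Fintype P] {d : P → ℕ} (k₀ : P) (A B : Op d) :
    (partialTranspose k₀ A * partialTranspose k₀ B).trace = (A * B).trace := by
  simp only [Matrix.trace, Matrix.diag, Matrix.mul_apply]
  rw [← Fintype.sum_prod_type', ← Fintype.sum_prod_type']
  exact Fintype.sum_equiv (swapAt k₀) _ _ fun u => rfl

/-- Complex conjugation of the operator of the party `k₀`. -/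
def conjAt {d d' : P → ℕ} (k₀ : P) (A : ∀ k, Matrix (Fin (d' k)) (Fin (d k)) ℂ) :
    ∀ k, Matrix (Fin (d' k)) (Fin (d k)) ℂ :=
  fun k => if k = k₀ then (A k).map star else A k

theorem conj_mul_apply {m n : Type*} [Fintype n] (A : Matrix m n ℂ) (ρ : Matrix n n ℂ) (x y : m) :
    (A * ρ * Aᴴ) x y = ∑ u : n × n, A x u.1 * star (A y u.2) * ρ u.1 u.2 := by
  rw [Fintype.sum_prod_type_right]
  simp only [Matrix.mul_apply, Finset.sum_mul, Matrix.conjTranspose_apply]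
  refine Finset.sum_congr rfl fun v _ => Finset.sum_congr rfl fun u _ => by ring

/-- Transposing one tensor factor of A ρ A† swaps the two sides of that factor, so the Kraus
operator there becomes its complex conjugate. The form of a conjugation survives, hence so does
positivity. -/
theorem partialTranspose_localTensor_conj [Fintype P] {d d' : P → ℕ} (k₀ : P)
    (A : ∀ k, Matrix (Fin (d' k)) (Fin (d k)) ℂ) (ρ : Op d) :
    partialTranspose k₀ (localTensor A * ρ * (localTensor A)ᴴ) =
      localTensor (conjAt k₀ A) * partialTranspose k₀ ρ * (localTensor (conjAt k₀ A))ᴴ := by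
  ext x y
  rw [partialTranspose_apply, conj_mul_apply, conj_mul_apply]
  refine Fintype.sum_equiv (swapAt k₀) _ _ fun u => ?_
  have h1 : partialTranspose k₀ ρ (swapAt k₀ u).1 (swapAt k₀ u).2 = ρ u.1 u.2 := by
    simp [partialTranspose_apply, swapAt]
  rw [h1]
  congr 1
  simp only [localTensor, Matrix.of_apply, star_prod, ← Finset.prod_mul_distrib]
  refine Finset.prod_congr rfl fun k _ => ?_
  by_cases hk : k = k₀
  · subst hk
    simp [conjAt, swapAt, mul_comm]
  · simp [conjAt, swapAt, hk]

theorem SLOCC.run_posSemidef_partialTranspose [Fintype P] (k₀ : P) {e d : P → ℕ} (L : SLOCC e d)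
    (ρ : Op d) (h : (partialTranspose k₀ ρ).PosSemidef) :
    (partialTranspose k₀ (L.run ρ)).PosSemidef := by
  induction L with
  | accept => simpa [SLOCC.run] using h
  | reject d => simpa [SLOCC.run, partialTranspose_zero] using Matrix.PosSemidef.zero
  | round d r d' K complete next ih =>
    simp only [SLOCC.run]
    rw [partialTranspose_sum]
    refine Matrix.posSemidef_sum _ fun o _ => ih o _ ?_
    rw [partialTranspose_localTensor_conj]
    exact h.mul_mul_conjTranspose_same _

end PartialTranspose

/-! ### Many copies, and the obstruction to purification. -/

section Copies

variable {P : Type} {d : P → ℕ}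

theorem partialTranspose_copies [DecidableEq P] (k₀ : P) (n : ℕ) (ρ : Op d) :
    partialTranspose k₀ (copies n ρ) = copies n (partialTranspose k₀ ρ) := by
  ext x y
  simp only [partialTranspose_apply, copies, Matrix.of_apply]
  refine Finset.prod_congr rfl fun i _ => ?_
  congr 1 <;>
  · ext k
    by_cases hk : k = k₀
    · subst hk; simp
    · simp [hk]

theorem copies_conjTranspose (n : ℕ) (A : Op d) : copies n Aᴴ = (copies n A)ᴴ := by
  ext x y
  simp [copies, Matrix.conjTranspose_apply]

theorem copies_mul [Fintype P] [DecidableEq P] (n : ℕ) (A B : Op d) :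
    copies n (A * B) = copies n A * copies n B := by
  ext x y
  simp only [copies, Matrix.of_apply, Matrix.mul_apply, ← Finset.prod_mul_distrib]
  rw [Finset.prod_univ_sum, Fintype.piFinset_univ]
  -- A choice of an intermediate label for every copy is the same as one intermediate label of the
  -- joint system.
  exact Fintype.sum_equiv
    ((Equiv.piComm fun (_ : Fin n) (k : P) => Fin (d k)).trans
      (Equiv.piCongrRight fun _ => finFunctionFinEquiv)) _ _ fun z => by
        simp [Function.swap]

theorem copies_posSemidef [Fintype P] [DecidableEq P] (n : ℕ) {ρ : Op d} (h : ρ.PosSemidef) :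
    (copies n ρ).PosSemidef := by
  obtain ⟨B, rfl⟩ : ∃ B : Op d, ρ = Bᴴ * B := by
    open scoped MatrixOrder in
    exact CStarAlgebra.nonneg_iff_eq_star_mul_self.mp h.nonneg
  rw [copies_mul, copies_conjTranspose]
  exact Matrix.posSemidef_conjTranspose_mul_self _

/-- If the overlap of `ψ` with every state of positive partial transpose is at most `c < 1`, then
no state of positive partial transpose can be purified to `ψ`. -/
theorem not_purifiable_of_partialTranspose [Fintype P] [DecidableEq P] (k₀ : P) {ρ : Op d}
    {ψ : Ket d} {c : ℝ} (hc : c < 1)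
    (hψ : ∀ σ : Op d, (partialTranspose k₀ σ).PosSemidef →
      (star ψ ⬝ᵥ (σ *ᵥ ψ)).re ≤ c * σ.trace.re)
    (hρ : (partialTranspose k₀ ρ).PosSemidef) : ¬ Purifiable ρ ψ := by
  intro h
  -- With this ε the required fidelity is (1 + c)/2, which exceeds c.
  obtain ⟨n, L, hpos, hle⟩ := h ((1 - c) / 2) (by linarith)
  have hL : (partialTranspose k₀ (L.run (copies n ρ))).PosSemidef := by
    apply SLOCC.run_posSemidef_partialTranspose
    rw [partialTranspose_copies]
    exact copies_posSemidef n hρ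
  have := hψ _ hL
  nlinarith

end Copies

/-! ### Composition and mixing of protocols. -/

section Protocols

variable {P : Type}

/-- Run the second protocol on the accepted branches of the first one. -/
def SLOCC.bind {e f : P → ℕ} (M : SLOCC f e) : {d : P → ℕ} → SLOCC e d → SLOCC f d
  | _, .accept => M
  | _, .reject d => .reject d
  | _, .round d r d' K complete next => .round d r d' K complete fun o => SLOCC.bind M (next o)

variable [Fintype P] [DecidableEq P] {d e f : P → ℕ}

theorem SLOCC.run_zero (L : SLOCC e d) : L.run 0 = 0 := by
  induction L with
  | accept => rfl
  | reject d => rfl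
  | round d r d' K complete next ih => simp [SLOCC.run, ih]

theorem SLOCC.run_add (L : SLOCC e d) (ρ σ : Op d) : L.run (ρ + σ) = L.run ρ + L.run σ := by
  induction L with
  | accept => rfl
  | reject d => simp [SLOCC.run]
  | round d r d' K complete next ih =>
    simp [SLOCC.run, ih, Matrix.mul_add, Matrix.add_mul, Finset.sum_add_distrib]

theorem SLOCC.run_smul (L : SLOCC e d) (c : ℂ) (ρ : Op d) : L.run (c • ρ) = c • L.run ρ := by
  induction L with
  | accept => rfl
  | reject d => simp [SLOCC.run]
  | round d r d' K complete next ih => simp [SLOCC.run, ih, Finset.smul_sum]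

theorem SLOCC.run_sum (L : SLOCC e d) {ι : Type*} (s : Finset ι) (ρ : ι → Op d) :
    L.run (∑ i ∈ s, ρ i) = ∑ i ∈ s, L.run (ρ i) := by
  classical
  induction s using Finset.induction_on with
  | empty => simp [SLOCC.run_zero]
  | insert i s hi ih => rw [Finset.sum_insert hi, Finset.sum_insert hi, SLOCC.run_add, ih]

theorem SLOCC.run_bind (M : SLOCC f e) (L : SLOCC e d) (ρ : Op d) :
    (SLOCC.bind M L).run ρ = M.run (L.run ρ) := by
  induction L with
  | accept => rfl
  | reject d => simp [SLOCC.run, SLOCC.bind, SLOCC.run_zero]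
  | round d r d' K complete next ih => simp [SLOCC.run, SLOCC.bind, ih, SLOCC.run_sum]

theorem Convertible.trans {ρ : Op d} {σ : Op e} {τ : Op f} (h₁ : Convertible ρ σ)
    (h₂ : Convertible σ τ) : Convertible ρ τ := by
  obtain ⟨L, rfl⟩ := h₁
  obtain ⟨M, rfl⟩ := h₂
  exact ⟨SLOCC.bind M L, SLOCC.run_bind M L ρ⟩

/-- A single round of measurements, all of whose outcomes lead to the same local dimensions. -/
theorem convertible_of_round (r : P → ℕ) (K : ∀ k, Fin (r k) → Matrix (Fin (e k)) (Fin (d k)) ℂ)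
    (complete : ∀ k, ∑ i, (K k i)ᴴ * K k i = 1) (ρ : Op d) :
    Convertible ρ (∑ o : ∀ k, Fin (r k),
      localTensor (fun k => K k (o k)) * ρ * (localTensor fun k => K k (o k))ᴴ) :=
  ⟨.round d r (fun k _ => e k) K complete fun _ => .accept, rfl⟩

/-- All systems can be discarded. -/
theorem convertible_one_of_trace_eq_one {ρ : Op d} (h : ρ.trace = 1) :
    Convertible ρ (1 : Op (fun _ : P => 1)) := by
  -- Each party measures in its computational basis with Kraus operators ⟨i|, leaving a
  -- one-dimensional system; the branch weights are the diagonal entries and add up to the trace.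
  have key := convertible_of_round (e := fun _ => 1) d
    (fun k i => Matrix.of fun (_ : Fin 1) j => if j = i then (1 : ℂ) else 0)
    (fun k => by
      ext a b
      simp [Matrix.sum_apply, Matrix.mul_apply, Matrix.one_apply, eq_comm]) ρ
  convert key
  ext x y
  have hxy : x = y := Subsingleton.elim _ _
  subst hxy
  rw [Matrix.one_apply_eq]
  refine h.symm.trans ?_
  rw [Matrix.sum_apply, Matrix.trace]
  refine Finset.sum_congr rfl fun o _ => ?_
  have hl : ∀ u : ∀ k, Fin (d k),
      (∏ k, if u k = o k then (1 : ℂ) else 0) = if u = o then 1 else 0 := by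
    intro u
    rw [Finset.prod_ite_zero]
    simp [funext_iff]
  rw [conj_mul_apply, Fintype.sum_prod_type]
  simp [localTensor, hl]

end Protocols

/-- Two protocols can be applied at random, the first party announcing which. -/
theorem Convertible.mix {d e : Fin 2 → ℕ} {ρ : Op d} {σ τ : Op e} {s t : ℝ} (hs : 0 ≤ s)
    (ht : 0 ≤ t) (hst : s + t = 1) (h₁ : Convertible ρ σ) (h₂ : Convertible ρ τ) :
    Convertible ρ ((s : ℂ) • σ + (t : ℂ) • τ) := by
  obtain ⟨L, rfl⟩ := h₁
  obtain ⟨M, rfl⟩ := h₂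
  have hss : ((√s : ℝ) : ℂ) * (√s : ℝ) = s := by
    rw [← Complex.ofReal_mul, Real.mul_self_sqrt hs]
  have htt : ((√t : ℝ) : ℂ) * (√t : ℝ) = t := by
    rw [← Complex.ofReal_mul, Real.mul_self_sqrt ht]
  have hst' : (s : ℂ) + t = 1 := by exact_mod_cast hst
  -- The first party tosses the coin. The second gets a dummy second outcome with Kraus operator 0,
  -- so that both have two outcomes.
  let q : Fin 2 → Fin 2 → ℝ := ![![√s, √t], ![1, 0]]
  have hT : ∀ o : Fin 2 → Fin 2,
      localTensor (fun k => ((q k (o k) : ℝ) : ℂ) • (1 : Matrix (Fin (d k)) (Fin (d k)) ℂ)) =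
        ((q 0 (o 0) : ℂ) * q 1 (o 1)) • (1 : Op d) := by
    intro o
    ext x y
    simp only [localTensor, Matrix.of_apply, Matrix.smul_apply, smul_eq_mul,
      Finset.prod_mul_distrib, Fin.prod_univ_two]
    congr 1
    by_cases h : x = y
    · subst h; simp
    · have : ¬ (x 0 = y 0 ∧ x 1 = y 1) := fun h' => h (by
        ext k; fin_cases k
        · exact congrArg _ h'.1
        · exact congrArg _ h'.2)
      rw [Matrix.one_apply_ne h]
      simp only [Matrix.one_apply]
      by_cases h0 : x 0 = y 0 <;> by_cases h1 : x 1 = y 1 <;> simp_all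
  refine ⟨.round d (fun _ => 2) (fun k _ => d k) (fun k i => ((q k i : ℝ) : ℂ) • 1) ?_
    fun o => if o 0 = 0 then L else M, ?_⟩
  · intro k
    fin_cases k
    · simp [q, Fin.sum_univ_two, smul_smul, Real.mul_self_sqrt hs, Real.mul_self_sqrt ht, ← add_smul, hst]
    · simp [q, Fin.sum_univ_two]
  · rw [SLOCC.run]
    simp only [hT]
    rw [← (finTwoArrowEquiv (Fin 2)).symm.sum_comp, Fintype.sum_prod_type]
    simp [q, Fin.sum_univ_two, SLOCC.run_smul, smul_smul, hss, htt]

/-! ### Conversion of the two-qubit state into the noisy chain. -/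

theorem bipartite_apply (ρ : Op (qubits 3)) (x y : ∀ k, Fin (aliceBob k)) :
    bipartite ρ x y = ρ (splitLabel x) (splitLabel y) := rfl

theorem sum_fin_two_mul_two {M : Type*} [AddCommMonoid M] (f : Fin (2 * 2) → M) :
    ∑ z, f z = ∑ b : Fin 2, ∑ c : Fin 2, f (finProdFinEquiv (b, c)) := by
  rw [← finProdFinEquiv.sum_comp, Fintype.sum_prod_type]

theorem czSign_mul_self (a b : Fin 2) : czSign a b * czSign a b = 1 := by
  unfold czSign; split_ifs <;> simp

theorem ofReal_inv_sqrt_two_mul_self : ((1 / √2 : ℝ) : ℂ) * ((1 / √2 : ℝ) : ℂ) = 1 / 2 := by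
  rw [← Complex.ofReal_mul, div_mul_div_comm, Real.mul_self_sqrt (by norm_num)]
  norm_num

/-- The isometry `|b⟩ ↦ CZ |b⟩|+⟩`, which appends a qubit to a chain. -/
noncomputable def appendQubit : Matrix (Fin (2 * 2)) (Fin 2) ℂ :=
  Matrix.of fun z b => if b = (finProdFinEquiv.symm z).1 then
    czSign (finProdFinEquiv.symm z).1 (finProdFinEquiv.symm z).2 * ((1 / √2 : ℝ) : ℂ) else 0

theorem appendQubit_isometry : appendQubitᴴ * appendQubit = 1 := by
  ext a b
  rw [Matrix.mul_apply, sum_fin_two_mul_two]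
  simp only [appendQubit, conjTranspose_apply, of_apply, Equiv.symm_apply_apply]
  have h := ofReal_inv_sqrt_two_mul_self
  fin_cases a <;> fin_cases b <;>
    simp only [Fin.sum_univ_two, czSign] <;> simp <;> push_cast at h <;> simp at h <;>
    rw [h] <;> norm_num

/-- The first party does nothing, the second one appends a qubit. -/
noncomputable def appendKraus : ∀ k : Fin 2, Matrix (Fin (aliceBob k)) (Fin (qubits 2 k)) ℂ
  | 0 => (1 : Matrix (Fin 2) (Fin 2) ℂ)
  | 1 => appendQubit

theorem appendKraus_isometry : ∀ k, (appendKraus k)ᴴ * appendKraus k = 1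
  | 0 => by
    have h : (1 : Matrix (Fin 2) (Fin 2) ℂ)ᴴ * (1 : Matrix (Fin 2) (Fin 2) ℂ) = 1 := by simp
    exact h
  | 1 => appendQubit_isometry

theorem localTensor_appendKraus (x : ∀ k, Fin (aliceBob k)) (u : Fin 2 → Fin 2) :
    localTensor appendKraus x u = if u = ![splitLabel x 0, splitLabel x 1] then
      czSign (splitLabel x 1) (splitLabel x 2) * ((1 / √2 : ℝ) : ℂ) else 0 := by
  have h : localTensor appendKraus x u =
      (1 : Matrix (Fin 2) (Fin 2) ℂ) (splitLabel x 0) (u 0) *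
        if u 1 = splitLabel x 1 then
          czSign (splitLabel x 1) (splitLabel x 2) * ((1 / √2 : ℝ) : ℂ) else 0 := by
    rw [localTensor, of_apply, Fin.prod_univ_two]
    rfl
  have hu : u = ![splitLabel x 0, splitLabel x 1] ↔
      splitLabel x 0 = u 0 ∧ u 1 = splitLabel x 1 := by
    rw [funext_iff, Fin.forall_fin_two]
    simp [eq_comm]
  rw [h, Matrix.one_apply]
  simp only [hu]
  by_cases h0 : splitLabel x 0 = u 0 <;> simp [h0]

theorem convertible_pairState_pairPart (p : ℝ) :
    Convertible (pairState p) (bipartite (pairPart p)) := by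
  have key := convertible_of_round (e := aliceBob) (d := qubits 2) (fun _ => 1)
    (fun k _ => appendKraus k)
    (fun k => by rw [Fintype.sum_unique, appendKraus_isometry]) (pairState p)
  convert key
  rw [Fintype.sum_unique]
  ext x y
  rw [conj_mul_apply, Fintype.sum_prod_type]
  simp only [localTensor_appendKraus]
  rw [Finset.sum_eq_single ![splitLabel x 0, splitLabel x 1] (by
      intro u _ hu
      simp [hu]) (by simp),
    Finset.sum_eq_single ![splitLabel y 0, splitLabel y 1] (by
      intro u _ hu
      simp [hu]) (by simp)]
  rw [bipartite_apply, pairPart, pairState, graphDiag_chain_three_apply,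
    graphDiag_chain_two_apply]
  have hs := ofReal_inv_sqrt_two_mul_self
  simp only [if_true, star_mul', star_czSign, Complex.star_def, Complex.conj_ofReal]
  generalize splitLabel x = x', splitLabel y = y', ((1 / √2 : ℝ) : ℂ) = r at hs ⊢
  -- The squared amplitude 1/2 of the new qubit turns the normalization 1/4 of the pair into the 1/8
  -- of the chain.
  have hr : ∀ s t q : ℂ, s * r * (t * r) * q = s * t * q * (1 / 2) := by
    intro s t q
    rw [← hs]; ring
  rw [hr]
  simp only [Fin.sum_univ_two, cons_val_zero, cons_val_one]
  have h0 : ∀ a : Fin 2, czSign 0 a = 1 := by intro a; simp [czSign]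
  simp [h0]
  ring

/-- Kraus operators for the preparation of a maximally mixed qubit by the first party, and of an
equal mixture of `|0⟩|-⟩` and `|1⟩|+⟩` by the second one. -/
noncomputable def mixedKraus : ∀ k : Fin 2, Fin 2 → Matrix (Fin (aliceBob k)) (Fin 1) ℂ
  | 0 => fun i => (Matrix.of fun a _ => if a = i then ((1 / √2 : ℝ) : ℂ) else 0 :
      Matrix (Fin 2) (Fin 1) ℂ)
  | 1 => fun i => (Matrix.of fun z _ => if (finProdFinEquiv.symm z).1 = i then
      1 / 2 * czSign (1 - (finProdFinEquiv.symm z).1) (finProdFinEquiv.symm z).2 else 0 :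
      Matrix (Fin (2 * 2)) (Fin 1) ℂ)

theorem mixedKraus_complete (k : Fin 2) : ∑ i, (mixedKraus k i)ᴴ * mixedKraus k i = 1 := by
  have h : ∀ i a, ∑ z, star (mixedKraus k i z a) * mixedKraus k i z a = 1 / 2 := by
    intro i a
    have hr := ofReal_inv_sqrt_two_mul_self
    simp only [one_div, Complex.ofReal_inv] at hr
    fin_cases k
    · refine (Fin.sum_univ_two _).trans ?_
      simp only [mixedKraus, of_apply]
      fin_cases i <;> simp [hr]
    · refine (sum_fin_two_mul_two _).trans ?_
      simp only [mixedKraus, of_apply, Equiv.symm_apply_apply]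
      fin_cases i <;> simp [Fin.sum_univ_two, czSign, map_ofNat] <;> norm_num
  ext a b
  obtain rfl : a = b := Subsingleton.elim _ _
  rw [Matrix.one_apply_eq, Matrix.sum_apply]
  simp only [Matrix.mul_apply, conjTranspose_apply]
  exact (Finset.sum_congr rfl fun i _ => h i a).trans (by simp)

theorem localTensor_mixedKraus (o : Fin 2 → Fin 2) (x : ∀ k, Fin (aliceBob k))
    (u : Fin 2 → Fin 1) :
    localTensor (fun k => mixedKraus k (o k)) x u =
      (if splitLabel x 0 = o 0 then ((1 / √2 : ℝ) : ℂ) else 0) *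
        if splitLabel x 1 = o 1 then 1 / 2 * czSign (1 - splitLabel x 1) (splitLabel x 2)
        else 0 := by
  rw [localTensor, of_apply, Fin.prod_univ_two]
  rfl

theorem convertible_one_mixedPart :
    Convertible (1 : Op (fun _ : Fin 2 => 1)) (bipartite mixedPart) := by
  have key := convertible_of_round (e := aliceBob) (d := fun _ : Fin 2 => 1) (fun _ => 2)
    mixedKraus mixedKraus_complete 1
  convert key
  ext x y
  rw [Matrix.sum_apply, sum_fin_two_arrow]
  simp only [Matrix.mul_one, Matrix.mul_apply, conjTranspose_apply, localTensor_mixedKraus,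
    Finset.sum_const, Finset.card_univ, Fintype.card_pi, Fintype.card_fin, Finset.prod_const_one,
    one_smul]
  rw [bipartite_apply, mixedPart, graphDiag_chain_three_apply]
  have hs := ofReal_inv_sqrt_two_mul_self
  have hstar : star ((1 / √2 : ℝ) : ℂ) = ((1 / √2 : ℝ) : ℂ) := by
    rw [Complex.star_def, Complex.conj_ofReal]
  generalize splitLabel x = x', splitLabel y = y', ((1 / √2 : ℝ) : ℂ) = r at hs hstar ⊢
  simp only [Fin.sum_univ_two, cons_val_zero, cons_val_one]
  generalize x' 0 = x0, x' 1 = x1, x' 2 = x2, y' 0 = y0, y' 1 = y1, y' 2 = y2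
  have hstar' : (starRingEnd ℂ) r = r := hstar
  have hs' : r * r = 2⁻¹ := by rw [hs]; norm_num
  have hr' : ∀ s t : ℂ, r * s * (r * t) = s * t * 2⁻¹ := by
    intro s t
    rw [← hs']; ring
  fin_cases x0 <;> fin_cases x1 <;> fin_cases x2 <;> fin_cases y0 <;> fin_cases y1 <;>
    fin_cases y2 <;> simp [czSign, hstar', hr'] <;> norm_num

theorem trace_proj_graphBasis_chain_two (j : Fin 2 → Fin 2) :
    (proj (graphBasis (chain 2) j)).trace = 1 := by
  simp only [Matrix.trace, Matrix.diag_apply, proj_graphBasis_chain_two]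
  have h : ∀ a b c d e f : Fin 2, czSign a b * czSign c d * czSign e f *
      (czSign a b * czSign c d * czSign e f) = 1 := by
    intro a b c d e f
    linear_combination (czSign c d * czSign c d * (czSign e f * czSign e f)) * czSign_mul_self a b
      + (czSign e f * czSign e f) * czSign_mul_self c d + czSign_mul_self e f
  simp [h]

theorem weight_sum (p : ℝ) : (wa p + 2 * wb p + wc p) + 4 * wb p = 1 := by
  unfold wa wb wc; ring

theorem weight_pos (p : ℝ) : 0 < wa p + 2 * wb p + wc p := by
  unfold wa wb wc; nlinarith [sq_nonneg (1 - 4 * p / 3)]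

theorem wb_nonneg {p : ℝ} (h0 : 0 ≤ p) (h1 : p ≤ 1) : 0 ≤ wb p := by
  unfold wb; nlinarith

theorem trace_pairState (p : ℝ) : (pairState p).trace = 1 := by
  have hw : (wa p + 2 * wb p + wc p : ℝ) ≠ 0 := (weight_pos p).ne'
  rw [pairState, graphDiag, trace_sum, sum_fin_two_arrow]
  simp only [trace_smul, trace_proj_graphBasis_chain_two, smul_eq_mul, mul_one]
  norm_cast
  simp [pairWeight, Fin.sum_univ_two]
  field_simp
  ring

theorem graphDiag_add {n : ℕ} (G : SimpleGraph (Fin n)) [DecidableRel G.Adj]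
    (l m : (Fin n → Fin 2) → ℝ) : graphDiag G (l + m) = graphDiag G l + graphDiag G m := by
  simp [graphDiag, add_smul, Finset.sum_add_distrib]

theorem graphDiag_smul {n : ℕ} (G : SimpleGraph (Fin n)) [DecidableRel G.Adj]
    (c : ℝ) (l : (Fin n → Fin 2) → ℝ) : graphDiag G (c • l) = (c : ℂ) • graphDiag G l := by
  simp [graphDiag, mul_smul, Finset.smul_sum]

theorem chainDiag_eq_mix (p : ℝ) :
    chainDiag p =
      ((wa p + 2 * wb p + wc p : ℝ) : ℂ) • pairPart p + ((4 * wb p : ℝ) : ℂ) • mixedPart := by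
  have hw : wa p + 2 * wb p + wc p ≠ 0 := (weight_pos p).ne'
  rw [chainDiag, pairPart, mixedPart, ← graphDiag_smul, ← graphDiag_smul, ← graphDiag_add]
  congr 1
  ext j
  have hcancel : ∀ t, (wa p + 2 * wb p + wc p) * (t / (wa p + 2 * wb p + wc p)) = t := fun t =>
    mul_div_cancel₀ t hw
  simp only [Pi.add_apply, Pi.smul_apply, smul_eq_mul, pairWeight, mul_ite, hcancel]
  generalize j 0 = a, j 1 = b, j 2 = c
  fin_cases a <;> fin_cases b <;> fin_cases c <;> simp <;> ring

/-- For the `mixedPart` branch the pair is discarded and the state is prepared from nothing. -/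
theorem convertible_pairState_chainDiag {p : ℝ} (h0 : 0 ≤ p) (h1 : p ≤ 1) :
    Convertible (pairState p) (bipartite (chainDiag p)) := by
  rw [chainDiag_eq_mix]
  exact Convertible.mix (weight_pos p).le (by linarith [wb_nonneg h0 h1]) (weight_sum p)
    (convertible_pairState_pairPart p)
    ((convertible_one_of_trace_eq_one (trace_pairState p)).trans convertible_one_mixedPart)

/-! ### Partial transpose of the chain and the overlap bound. -/

theorem graphDiag_posSemidef {n : ℕ} (G : SimpleGraph (Fin n)) [DecidableRel G.Adj]
    {l : (Fin n → Fin 2) → ℝ} (h : ∀ j, 0 ≤ l j) : (graphDiag G l).PosSemidef :=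
  Matrix.posSemidef_sum _ fun j _ =>
    (Matrix.posSemidef_vecMulVec_self_star _).smul (by exact_mod_cast h j)

set_option maxHeartbeats 4000000 in
/-- The partial transpose with respect to the first qubit keeps operators diagonal in the basis of
graph states of the chain. -/
theorem partialTranspose_graphDiag (l : (Fin 3 → Fin 2) → ℝ) :
    partialTranspose (0 : Fin 3) (graphDiag (chain 3) l) = graphDiag (chain 3) fun j =>
      (∑ a, ∑ b, l ![a, b, j 2]) / 2 - l ![1 - j 0, 1 - j 1, j 2] := by
  -- In stabilizer terms, transposing the first qubit reverses the sign of exactly the elements with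
  -- a Y there, K₁K₂ and K₁K₂K₃. The formula is the resulting change of weights; it is checked on
  -- all entries.
  ext x y
  rw [partialTranspose_apply, graphDiag_chain_three_apply, graphDiag_chain_three_apply]
  have e1 : ∀ (z : Fin 3 → Fin 2) (a : Fin 2), Function.update z 0 a 1 = z 1 := by simp
  have e2 : ∀ (z : Fin 3 → Fin 2) (a : Fin 2), Function.update z 0 a 2 = z 2 := by simp
  simp only [Function.update_self, e1, e2, Fin.sum_univ_two]
  generalize x 0 = x0, x 1 = x1, x 2 = x2, y 0 = y0, y 1 = y1, y 2 = y2
  fin_cases x0 <;> fin_cases x1 <;> fin_cases x2 <;> fin_cases y0 <;> fin_cases y1 <;>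
    fin_cases y2 <;> simp [czSign] <;> ring

/-- The graph basis is orthonormal, so the constant weight 1/2 gives half the identity. -/
theorem graphDiag_half_sub (l : (Fin 3 → Fin 2) → ℝ)
    (hl : ∀ a b c, l ![a, b, c] = if a = 0 ∧ b = 0 ∧ c = 0 then -1 / 2 else 1 / 2) :
    graphDiag (chain 3) l = (1 / 2 : ℂ) • (1 : Op (qubits 3)) - proj (graphState (chain 3)) := by
  ext x y
  have hxy : x = y ↔ x 0 = y 0 ∧ x 1 = y 1 ∧ x 2 = y 2 := by
    rw [funext_iff, Fin.forall_fin_succ, Fin.forall_fin_two]; rfl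
  rw [graphDiag_chain_three_apply, graphState_eq_graphBasis, Matrix.sub_apply, Matrix.smul_apply,
    Matrix.one_apply, proj_graphBasis_chain_three]
  simp only [hxy, hl, Fin.sum_univ_two, Pi.zero_apply]
  generalize x 0 = x0, x 1 = x1, x 2 = x2, y 0 = y0, y 1 = y1, y 2 = y2
  fin_cases x0 <;> fin_cases x1 <;> fin_cases x2 <;> fin_cases y0 <;> fin_cases y1 <;>
    fin_cases y2 <;> simp [czSign] <;> norm_num

/-- A state of positive partial transpose has overlap at most `1 / 2` with the chain. -/
theorem overlap_le_half (σ : Op (qubits 3)) (h : (partialTranspose (0 : Fin 3) σ).PosSemidef) :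
    (star (graphState (chain 3)) ⬝ᵥ (σ *ᵥ graphState (chain 3))).re ≤ 1 / 2 * σ.trace.re := by
  -- These are the weights of the partial transpose of 1/2 - |ψ⟩⟨ψ|, an involution. Being
  -- nonnegative, they make its trace against a positive operator nonnegative.
  let l : (Fin 3 → Fin 2) → ℝ := fun j =>
    if j 2 = 1 then 1 / 2 else if j 0 = 1 ∧ j 1 = 1 then 1 else 0
  have hl : ∀ j, 0 ≤ l j := by
    intro j; simp only [l]; split_ifs <;> norm_num
  have hPT : partialTranspose (0 : Fin 3) (graphDiag (chain 3) l) =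
      (1 / 2 : ℂ) • (1 : Op (qubits 3)) - proj (graphState (chain 3)) := by
    rw [partialTranspose_graphDiag]
    apply graphDiag_half_sub
    intro a b c
    fin_cases a <;> fin_cases b <;> fin_cases c <;> simp [l, Fin.sum_univ_two] <;> norm_num
  have hinv : partialTranspose (0 : Fin 3) (partialTranspose (0 : Fin 3) σ) = σ := by
    ext x y
    simp [partialTranspose_apply]
  have htr : (graphDiag (chain 3) l * partialTranspose (0 : Fin 3) σ).trace =
      1 / 2 * σ.trace - star (graphState (chain 3)) ⬝ᵥ (σ *ᵥ graphState (chain 3)) := by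
    rw [← trace_partialTranspose_mul (0 : Fin 3), hPT, hinv, Matrix.sub_mul, Matrix.trace_sub,
      Matrix.smul_mul, Matrix.one_mul, Matrix.trace_smul, smul_eq_mul, proj,
      Matrix.vecMulVec_mul, Matrix.trace_vecMulVec, dotProduct_comm, Matrix.dotProduct_mulVec]
  have hnn : 0 ≤ (graphDiag (chain 3) l * partialTranspose (0 : Fin 3) σ).trace := by
    rw [graphDiag, Finset.sum_mul, Matrix.trace_sum]
    refine Finset.sum_nonneg fun j _ => ?_
    rw [Matrix.smul_mul, Matrix.trace_smul, smul_eq_mul, proj, Matrix.vecMulVec_mul,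
      Matrix.trace_vecMulVec, dotProduct_comm, ← Matrix.dotProduct_mulVec]
    exact mul_nonneg (by exact_mod_cast hl j) (h.dotProduct_mulVec_nonneg _)
  rw [htr] at hnn
  have hre := (Complex.le_def.mp hnn).1
  have h2 : (1 / 2 * σ.trace).re = 1 / 2 * σ.trace.re := by
    rw [show (1 / 2 : ℂ) = ((1 / 2 : ℝ) : ℂ) by norm_num, Complex.re_ofReal_mul]
  rw [Complex.sub_re, h2, Complex.zero_re] at hre
  linarith

/-! ### The cubic criterion and its threshold. -/

/-- In terms of x the condition is 4x³ + x² - 1 ≤ 0; the cubic in p is 27/4 times its left side. -/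
theorem ratio_le_half_iff (p : ℝ) :
    wa p / (wa p + 2 * wb p + wc p) ≤ 1 / 2 ↔
      27 - 126 * p + 156 * p ^ 2 - 64 * p ^ 3 ≤ 0 := by
  rw [div_le_iff₀ (weight_pos p)]
  unfold wa wb wc
  constructor <;> intro h <;> nlinarith

theorem not_purifiable_chain {p : ℝ} (h0 : 0 ≤ p) (h1 : p ≤ 1)
    (h : 27 - 126 * p + 156 * p ^ 2 - 64 * p ^ 3 ≤ 0) :
    ¬ Purifiable (chainDiag p) (graphState (chain 3)) := by
  refine not_purifiable_of_partialTranspose (0 : Fin 3) (by norm_num) overlap_le_half ?_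
  have ha : wa p ≤ (wa p + 2 * wb p + wc p) / 2 := by
    have := (ratio_le_half_iff p).mpr h
    rw [div_le_iff₀ (weight_pos p)] at this
    linarith
  have hb := wb_nonneg h0 h1
  -- Since 4(1 - p) = 1 + 3x and p = 3(1 - x)/4, the hints below encode -1/3 ≤ x ≤ 1. The bounds on
  -- `wa` and `wc` give b, c ≤ w/2, the conditions left besides a ≤ w/2 and b ≥ 0.
  have ha0 : 0 ≤ wa p := by
    unfold wa
    nlinarith [mul_nonneg (sq_nonneg (1 - 4 * p / 3)) (by linarith : 0 ≤ 4 * (1 - p))]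
  have hc : wc p ≤ wa p + 2 * wb p := by
    unfold wa wb wc
    nlinarith [mul_nonneg (sq_nonneg (1 - 4 * p / 3)) (by linarith : 0 ≤ 4 * (1 - p)),
      mul_nonneg h0 (sub_nonneg.mpr h1)]
  have hc0 : 0 ≤ wc p := by
    unfold wc
    nlinarith [mul_nonneg (sq_nonneg (1 - 4 * p / 3)) h0, mul_nonneg h0 (sub_nonneg.mpr h1)]
  rw [chainDiag, partialTranspose_graphDiag]
  refine graphDiag_posSemidef _ fun j => ?_
  generalize j 0 = a, j 1 = b, j 2 = c
  fin_cases a <;> fin_cases b <;> fin_cases c <;> simp [Fin.sum_univ_two] <;> linarith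

/-- The threshold below which the criterion does not apply. -/
theorem exists_threshold : ∃ p₀ : ℝ, |p₀ - 0.332| < 0.0005 ∧
    27 - 126 * p₀ + 156 * p₀ ^ 2 - 64 * p₀ ^ 3 = 0 ∧
    ∀ p : ℝ, 0 ≤ p → p ≤ 1 →
      (27 - 126 * p + 156 * p ^ 2 - 64 * p ^ 3 ≤ 0 ↔ p₀ ≤ p) := by
  have hc : ContinuousOn (fun p : ℝ => 27 - 126 * p + 156 * p ^ 2 - 64 * p ^ 3)
      (Set.Icc 0.332 0.33249) := by fun_prop
  obtain ⟨p₀, ⟨hl, hu⟩, hp₀⟩ := intermediate_value_Icc' (by norm_num) hc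
    (show (0 : ℝ) ∈ Set.Icc _ _ by constructor <;> norm_num)
  have hp : 27 - 126 * p₀ + 156 * p₀ ^ 2 - 64 * p₀ ^ 3 = 0 := hp₀
  refine ⟨p₀, by rw [abs_lt]; constructor <;> linarith, hp, fun p h0 h1 => ?_⟩
  -- Completing the square in p leaves 48p₀² - 78p₀ + 495/16, positive because p₀ lies below its
  -- smaller root 11/16.
  have hq : 0 < 126 - 156 * (p + p₀) + 64 * (p ^ 2 + p * p₀ + p₀ ^ 2) := by
    nlinarith [sq_nonneg (p + p₀ / 2 - 39 / 32)]
  have hf : 27 - 126 * p + 156 * p ^ 2 - 64 * p ^ 3 =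
      (p₀ - p) * (126 - 156 * (p + p₀) + 64 * (p ^ 2 + p * p₀ + p₀ ^ 2)) := by
    linear_combination hp
  rw [hf]
  constructor
  · intro h
    by_contra! hlt
    nlinarith [mul_pos (sub_pos.mpr hlt) hq]
  · intro h
    nlinarith [mul_nonneg (sub_nonneg.mpr h) hq.le]

end GraphPurification

open GraphPurification in
theorem mainTheorem6 :
    (∀ p : ℝ, 0 ≤ p → p ≤ 1 →
      noisyGraphState (chain 3) p = chainDiag p ∧
      0 < wa p + 2 * wb p + wc p ∧ 0 ≤ wb p ∧ (wa p + 2 * wb p + wc p) + 4 * wb p = 1 ∧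
      noisyGraphState (chain 3) p =
        ((wa p + 2 * wb p + wc p : ℝ) : ℂ) • pairPart p + ((4 * wb p : ℝ) : ℂ) • mixedPart ∧
      Convertible (pairState p) (bipartite (pairPart p)) ∧
      Convertible (1 : Op (fun _ : Fin 2 => 1)) (bipartite mixedPart) ∧
      Convertible (pairState p) (bipartite (noisyGraphState (chain 3) p)) ∧
      (wa p / (wa p + 2 * wb p + wc p) ≤ 1 / 2 ↔
        27 - 126 * p + 156 * p ^ 2 - 64 * p ^ 3 ≤ 0) ∧
      (27 - 126 * p + 156 * p ^ 2 - 64 * p ^ 3 ≤ 0 →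
        ¬ Purifiable (noisyGraphState (chain 3) p) (graphState (chain 3)))) ∧
    ∃ p₀ : ℝ, |p₀ - 0.332| < 0.0005 ∧
      27 - 126 * p₀ + 156 * p₀ ^ 2 - 64 * p₀ ^ 3 = 0 ∧
      ∀ p : ℝ, 0 ≤ p → p ≤ 1 →
        (27 - 126 * p + 156 * p ^ 2 - 64 * p ^ 3 ≤ 0 ↔ p₀ ≤ p) ∧
        (p₀ ≤ p → ¬ Purifiable (noisyGraphState (chain 3) p) (graphState (chain 3))) := by
  simp only [noisyGraphState_chain_three]
  refine ⟨fun p h0 h1 => ⟨trivial, weight_pos p, wb_nonneg h0 h1, weight_sum p, chainDiag_eq_mix p,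
    convertible_pairState_pairPart p, convertible_one_mixedPart,
    convertible_pairState_chainDiag h0 h1, ratio_le_half_iff p, not_purifiable_chain h0 h1⟩, ?_⟩
  obtain ⟨p₀, habs, hroot, hiff⟩ := exists_threshold
  exact ⟨p₀, habs, hroot, fun p h0 h1 => ⟨hiff p h0 h1, fun h =>
    not_purifiable_chain h0 h1 ((hiff p h0 h1).mpr h)⟩⟩
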